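/- Let $d\ge 0$ be an integer, let $\mathcal G$ be a finite family of subsets ("groups", possibly overlapping) of $\{1,\dots,d\}$, let $w_g>0$ $(g\in\mathcal G)$ be weights, and let $\lambda>0$, $\mathbf b\in\mathbb R^d$ and $\rho>0$. Put $n=\sum_{g\in\mathcal G}|g|$. Write $x\in\mathbb R^n$ as a concatenation of blocks $x_{j(g)}\in\mathbb R^{|g|}$, $g\in\mathcal G$, the entries of the block $x_{j(g)}$ being indexed by the elements of $g$, and let $M\in\{0,1\}^{d\times n}$ be the matrix that sums entries along each coordinate: $(Mx)_a=\sum_{g\ni a}(x_{j(g)})_a$ for $a=1,\dots,d$. Consider the split form of the proximal problem of the latent overlapping group lasso penalty, $$\min_{x^1,x^2\in\mathbb R^n}\ F(x^1,x^2)=\lambda\sum_{g\in\mathcal G}w_g\|x^1_{j(g)}\|_2+\tfrac12\|Mx^2-\mathbf b\|_2^2\quad\text{s.t. } x^1=x^2,\qquad(\mathrm P)$$ its augmented Lagrangian $L_\rho(x^1,x^2;y)=F(x^1,x^2)+\langle y,x^1-x^2\rangle+\frac\rho2\|x^1-x^2\|_2^2$ with $y\in\mathbb R^n$, and the dual problem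 $$\max_{y\in\mathbb R^n}\ g_\rho(y),\qquad g_\rho(y)=\inf_{x^1,x^2\in\mathbb R^n}L_\rho(x^1,x^2;y).\qquad(\mathrm D)$$ For a dual stepsize $\alpha>0$ and an arbitrary starting point, the ADMM iterates are, for $k\ge0$, $$x^{1,k+1}_{j(g)}=\operatorname*{argmin}_{v\in\mathbb R^{|g|}}\ \lambda w_g\|v\|_2+\tfrac\rho2\big\|v-x^{2,k}_{j(g)}+\tfrac1\rho y^k_{j(g)}\big\|_2^2\quad(g\in\mathcal G),$$ $$x^{2,k+1}=\operatorname*{argmin}_{v\in\mathbb R^n}\ \tfrac12\|Mv-\mathbf b\|_2^2+\tfrac\rho2\big\|v-x^{1,k+1}-\tfrac1\rho y^k\big\|_2^2,$$ $$y^{k+1}=y^k+\alpha\,(x^{1,k+1}-x^{2,k+1}).$$ Theorem. There is $\alpha_0>0$, depending only on $\mathcal G,w,\lambda,\mathbf b,\rho$, such that for every $\alpha\in(0,\alpha_0)$ every sequence $(x^{1,k},x^{2,k},y^k)_{k\ge0}$ of ADMM iterates converges linearly to a primal–dual optimal solution: there are an optimal solution $(x^{1,*},x^{2,*})$ of $(\mathrm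 P)$, an optimal solution $y^*$ of $(\mathrm D)$, and constants $C\ge 0$ and $q\in(0,1)$ with $$\|x^{1,k}-x^{1,*}\|_2+\|x^{2,k}-x^{2,*}\|_2+\|y^k-y^*\|_2\le C\,q^k\qquad\text{for all }k\ge0 .$$ No strong convexity is assumed; in particular $M$ need not have full column rank. -/

import Mathlib

namespace LOGProx

noncomputable section

section

variable {ι : Type*} [Fintype ι] {d : ℕ}

/-- Index set of the long vector `x = [ν⁽ᵍ⁾_g]_g`: one coordinate for every group and every
element of that group.  Its cardinality is `n = ∑ g, |g|`, and the block `j(g)` of a group `i`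
is the set of indices whose first component is `i`. -/
abbrev Idx (grp : ι → Finset (Fin d)) : Type _ := (i : ι) × {a : Fin d // a ∈ grp i}

/-- The space `ℝⁿ`, `n = ∑ g, |g|`, with the Euclidean norm. -/
abbrev Vec (grp : ι → Finset (Fin d)) : Type _ := EuclideanSpace ℝ (Idx grp)

/-- The space `ℝ^{|g|}` in which the block of the group `i` lives. -/
abbrev BlockVec (grp : ι → Finset (Fin d)) (i : ι) : Type _ :=
  EuclideanSpace ℝ {a : Fin d // a ∈ grp i}

/-- The block `x_{j(g)}` of `x` for the group `i`. -/
def block (grp : ι → Finset (Fin d)) (x : Vec grp) (i : ι) : BlockVec grp i :=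
  WithLp.toLp 2 fun a => x ⟨i, a⟩

/-- The binary `d × n` matrix `M` that sums the entries of `x` along each coordinate. -/
def sumMatrix (grp : ι → Finset (Fin d)) : Matrix (Fin d) (Idx grp) ℝ :=
  Matrix.of fun a p => if (p.2 : Fin d) = a then 1 else 0

/-- `M x`, an element of Euclidean space `ℝᵈ`. -/
def applyM (grp : ι → Finset (Fin d)) (x : Vec grp) : EuclideanSpace ℝ (Fin d) :=
  WithLp.toLp 2 ((sumMatrix grp).mulVec x.ofLp)

/-- `F(x¹, x²) = λ ∑ w_g ‖x¹_{j(g)}‖ + ½ ‖M x² - b‖²`. -/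
def objective (grp : ι → Finset (Fin d)) (lam : ℝ) (w : ι → ℝ)
    (b : EuclideanSpace ℝ (Fin d)) (x₁ x₂ : Vec grp) : ℝ :=
  lam * ∑ i, w i * ‖block grp x₁ i‖ + 1 / 2 * ‖applyM grp x₂ - b‖ ^ 2

/-- The augmented Lagrangian `L_ρ(x¹, x²; y)`. -/
def augLagrangian (grp : ι → Finset (Fin d)) (lam : ℝ) (w : ι → ℝ)
    (b : EuclideanSpace ℝ (Fin d)) (ρ : ℝ) (x₁ x₂ y : Vec grp) : ℝ :=
  objective grp lam w b x₁ x₂ + inner ℝ y (x₁ - x₂) + ρ / 2 * ‖x₁ - x₂‖ ^ 2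

/-- The augmented dual function `g_ρ(y) = inf_{x¹, x²} L_ρ(x¹, x²; y)`; the infimum is over a
set that is bounded below, see `bddBelow_augLagrangian`. -/
def augDual (grp : ι → Finset (Fin d)) (lam : ℝ) (w : ι → ℝ)
    (b : EuclideanSpace ℝ (Fin d)) (ρ : ℝ) (y : Vec grp) : ℝ :=
  ⨅ x : Vec grp × Vec grp, augLagrangian grp lam w b ρ x.1 x.2 y

theorem bddBelow_augLagrangian (grp : ι → Finset (Fin d)) {lam : ℝ} (hlam : 0 < lam)
    {w : ι → ℝ} (hw : ∀ i, 0 < w i) (b : EuclideanSpace ℝ (Fin d)) {ρ : ℝ} (hρ : 0 < ρ)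
    (y : Vec grp) :
    BddBelow (Set.range fun x : Vec grp × Vec grp =>
      augLagrangian grp lam w b ρ x.1 x.2 y) := by
  refine ⟨-(‖y‖ ^ 2 / (2 * ρ)), ?_⟩
  rintro _ ⟨⟨x₁, x₂⟩, rfl⟩
  have h1 : 0 ≤ objective grp lam w b x₁ x₂ := by
    have : 0 ≤ ∑ i, w i * ‖block grp x₁ i‖ :=
      Finset.sum_nonneg fun i _ => mul_nonneg (hw i).le (norm_nonneg _)
    unfold objective
    positivity
  have h2 := (abs_le.mp (abs_real_inner_le_norm y (x₁ - x₂))).1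
  have h3 : 0 ≤ (‖y‖ - ρ * ‖x₁ - x₂‖) ^ 2 / (2 * ρ) := by positivity
  have h4 : (‖y‖ - ρ * ‖x₁ - x₂‖) ^ 2 / (2 * ρ)
      = ‖y‖ ^ 2 / (2 * ρ) - ‖y‖ * ‖x₁ - x₂‖ + ρ / 2 * ‖x₁ - x₂‖ ^ 2 := by
    field_simp
    ring
  simp only [augLagrangian]
  linarith

/-- `(x¹, x²)` solves `min F(x¹, x²)` subject to `x¹ = x²`. -/
def IsPrimalOptimal (grp : ι → Finset (Fin d)) (lam : ℝ) (w : ι → ℝ)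
    (b : EuclideanSpace ℝ (Fin d)) (x₁ x₂ : Vec grp) : Prop :=
  x₁ = x₂ ∧ ∀ z₁ z₂ : Vec grp, z₁ = z₂ →
    objective grp lam w b x₁ x₂ ≤ objective grp lam w b z₁ z₂

/-- `y` solves the dual problem `max g_ρ(y)`. -/
def IsDualOptimal (grp : ι → Finset (Fin d)) (lam : ℝ) (w : ι → ℝ)
    (b : EuclideanSpace ℝ (Fin d)) (ρ : ℝ) (y : Vec grp) : Prop :=
  ∀ z : Vec grp, augDual grp lam w b ρ z ≤ augDual grp lam w b ρ y

/-- The sequences `x¹ᵏ`, `x²ᵏ`, `yᵏ` are generated by the two-block ADMM with penalty parameter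
`ρ` and dual stepsize `α`, from an arbitrary starting point. -/
structure IsADMM (grp : ι → Finset (Fin d)) (lam : ℝ) (w : ι → ℝ)
    (b : EuclideanSpace ℝ (Fin d)) (ρ α : ℝ) (x₁ x₂ y : ℕ → Vec grp) : Prop where
  step_x₁ : ∀ (k : ℕ) (i : ι), IsMinOn
    (fun v : BlockVec grp i => lam * w i * ‖v‖
      + ρ / 2 * ‖v - block grp (x₂ k) i + (1 / ρ) • block grp (y k) i‖ ^ 2)
    Set.univ (block grp (x₁ (k + 1)) i)
  step_x₂ : ∀ k : ℕ, IsMinOn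
    (fun v : Vec grp => 1 / 2 * ‖applyM grp v - b‖ ^ 2
      + ρ / 2 * ‖v - x₁ (k + 1) - (1 / ρ) • y k‖ ^ 2)
    Set.univ (x₂ (k + 1))
  step_y : ∀ k : ℕ, y (k + 1) = y k + α • (x₁ (k + 1) - x₂ (k + 1))

/-- The iterates converge (R-)linearly, at a geometric rate, to `(x¹*, x²*, y*)`. -/
def ConvergesLinearly {grp : ι → Finset (Fin d)} (x₁ x₂ y : ℕ → Vec grp)
    (x₁s x₂s ys : Vec grp) : Prop :=
  ∃ C q : ℝ, 0 < q ∧ q < 1 ∧ ∀ k : ℕ,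
    ‖x₁ k - x₁s‖ + ‖x₂ k - x₂s‖ + ‖y k - ys‖ ≤ C * q ^ k

end

end

end LOGProx

/-! The threshold is `α₀ = ρ`. Fix a KKT point `x₀` with multiplier `ys = Mᵀ(M x₀ - b)`, and let `S`
be the set of `x` with `M x = M x₀` at which `-ys` is a subgradient of the group norm. All points of
`S` share the multiplier `ys`, and each is optimal. For every `x ∈ S` the Lyapunov function `ρ‖x₂ -
x‖² + ‖y - ys‖²/α` drops in each step by at least `ρ‖x₁' - x₂‖² + (ρ - α)‖x₁' - x₂'‖² + 2‖M x₂' - M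
x₀‖²` (`fejer_step`); this is where `α < ρ` enters.

Strong convexity is replaced by an error bound. Where a multiple of the Euclidean norm has a given
subgradient is either the origin alone or a ray (or everything, on a trivial block), so `S` is the
linear image of a polyhedron `{t ≥ 0, A t = c}` with one multiplier per group. Hoffman's bound on
that polyhedron (`hoffman_bound`), with a blockwise estimate of the distance to the ray
(`exists_norm_sub_smul_le`), bounds the distance to `S` linearly by the residuals (`error_bound`).
The Lyapunov distance to `S` is thus at most a constant times the last decrease, hence contracts
geometrically, and Fejér monotonicity makes the iterates themselves converge
(`exists_geometric_bound_of_fejer`). -/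

namespace LOGProx

/-! ### Subgradients of the norm and the Lyapunov decrease -/

section Abstract

variable {E F : Type*} [NormedAddCommGroup E] [InnerProductSpace ℝ E]
  [NormedAddCommGroup F] [InnerProductSpace ℝ F]

/-- `s` is a subgradient of `φ` at `x`. -/
def IsSubgradient (φ : E → ℝ) (s x : E) : Prop :=
  ∀ z, φ x + inner ℝ s (z - x) ≤ φ z

/-- First-order optimality: a minimizer of `φ + ψ`, with `φ` convex and `ψ` smooth with gradient
`G` at the minimizer, has `-G` as a subgradient of `φ`. -/
theorem isSubgradient_of_isMinOn_add {φ ψ : E → ℝ} {x G : E} {K : ℝ}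
    (hφ : ConvexOn ℝ Set.univ φ) (hmin : ∀ v, φ x + ψ x ≤ φ v + ψ v)
    (hψ : ∀ v, ψ v ≤ ψ x + inner ℝ G (v - x) + K * ‖v - x‖ ^ 2) :
    IsSubgradient φ (-G) x := by
  intro z
  set D := φ z - φ x + inner ℝ G (z - x) with hD
  have key : ∀ ε : ℝ, 0 < ε → ε ≤ 1 → 0 ≤ D + ε * (K * ‖z - x‖ ^ 2) := by
    intro ε h0 h1
    have hc := hφ.2 (Set.mem_univ x) (Set.mem_univ z) (sub_nonneg.2 h1) h0.le (by ring)
    have hm := hmin ((1 - ε) • x + ε • z)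
    have hv : (1 - ε) • x + ε • z - x = ε • (z - x) := by module
    have hq := hψ ((1 - ε) • x + ε • z)
    rw [hv, inner_smul_right, norm_smul, mul_pow, Real.norm_eq_abs, sq_abs] at hq
    simp only [smul_eq_mul] at hc
    have : 0 ≤ ε * (D + ε * (K * ‖z - x‖ ^ 2)) := by rw [hD]; nlinarith
    exact nonneg_of_mul_nonneg_right this h0
  have hlim : Filter.Tendsto (fun ε : ℝ => D + ε * (K * ‖z - x‖ ^ 2))
      (nhdsWithin 0 (Set.Ioi 0)) (nhds (D + 0 * (K * ‖z - x‖ ^ 2))) :=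
    Filter.Tendsto.mono_left (Continuous.tendsto (by fun_prop) 0) nhdsWithin_le_nhds
  have h0 : 0 ≤ D + 0 * (K * ‖z - x‖ ^ 2) := by
    refine ge_of_tendsto hlim ?_
    filter_upwards [Ioo_mem_nhdsGT (zero_lt_one' ℝ)] with ε hε
    exact key ε hε.1 hε.2.le
  rw [inner_neg_left]
  linarith

theorem isSubgradient_const_mul_norm {c : ℝ} (hc : 0 < c) {s x : E}
    (h : IsSubgradient (fun v : E => c * ‖v‖) s x) : ‖s‖ ≤ c ∧ c • x = ‖x‖ • s := by
  have h0 := h 0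
  have h2 := h ((2 : ℝ) • x)
  have e2 : (2 : ℝ) • x - x = x := by module
  simp only [e2, norm_smul, Real.norm_ofNat, norm_zero, zero_sub, inner_neg_right] at h0 h2
  have hsx : inner ℝ s x = c * ‖x‖ := by linarith
  have hs : ‖s‖ ≤ c := by
    have hs := h s
    simp only [inner_sub_right, real_inner_self_eq_norm_sq, hsx] at hs
    by_contra! hlt
    nlinarith [norm_nonneg s]
  refine ⟨hs, ?_⟩
  -- Equality case of Cauchy–Schwarz: the square expands to `‖x‖²(‖s‖² - c²)`.
  have hn : ‖c • x - ‖x‖ • s‖ ^ 2 ≤ 0 := by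
    rw [norm_sub_sq_real, inner_smul_left, inner_smul_right, real_inner_comm, hsx, norm_smul,
      norm_smul]
    simp only [Real.norm_eq_abs, abs_norm, abs_of_pos hc, conj_trivial]
    nlinarith [mul_nonneg (sq_nonneg ‖x‖) (mul_nonneg (sub_nonneg.2 hs)
      (add_nonneg hc.le (norm_nonneg s)))]
  have : ‖c • x - ‖x‖ • s‖ = 0 := by nlinarith [norm_nonneg (c • x - ‖x‖ • s)]
  exact sub_eq_zero.1 (norm_eq_zero.1 this)

theorem isSubgradient_smul_self {c t : ℝ} {s : E} (hs : ‖s‖ ≤ c) (ht : 0 ≤ t)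
    (hts : ‖s‖ < c → t = 0) : IsSubgradient (fun v : E => c * ‖v‖) s (t • s) := by
  intro z
  have h1 : inner ℝ s z ≤ c * ‖z‖ :=
    (real_inner_le_norm s z).trans (mul_le_mul_of_nonneg_right hs (norm_nonneg z))
  have h2 : t * ‖s‖ ^ 2 = c * (t * ‖s‖) := by
    rcases hs.lt_or_eq with h | h
    · simp [hts h]
    · rw [h]; ring
  simp only [inner_sub_right, inner_smul_right, real_inner_self_eq_norm_sq, norm_smul,
    Real.norm_eq_abs, abs_of_nonneg ht]
  linarith

/-- Points of a bounded set at which the norm has a subgradient close to `s₀` are close to the ray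
of points at which `s₀` itself is a subgradient. -/
theorem exists_norm_sub_smul_le {c B : ℝ} (hc : 0 < c) (hB : 0 ≤ B) {s₀ : E} (hs₀ : ‖s₀‖ ≤ c) :
    ∃ K : ℝ, 0 ≤ K ∧ ∀ s x : E, ‖x‖ ≤ B → IsSubgradient (fun v : E => c * ‖v‖) s x →
      ∃ t : ℝ, 0 ≤ t ∧ (‖s₀‖ < c → t = 0) ∧ ‖x - t • s₀‖ ≤ K * ‖s - s₀‖ := by
  -- If `‖s₀‖ < c`, then `x ≠ 0` forces `‖s‖ = c`, so `‖s - s₀‖` is at least the gap `c - ‖s₀‖`,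
  -- while `‖x‖ ≤ B`. If `‖s₀‖ = c`, then `x = (‖x‖/c) s`, and the same multiplier applied to `s₀`
  -- works.
  rcases hs₀.lt_or_eq with hlt | heq
  · have hδ : 0 < c - ‖s₀‖ := sub_pos.2 hlt
    refine ⟨B / (c - ‖s₀‖), by positivity, fun s x hx h => ⟨0, le_rfl, fun _ => rfl, ?_⟩⟩
    obtain ⟨-, h2⟩ := isSubgradient_const_mul_norm hc h
    rw [zero_smul, sub_zero]
    rcases eq_or_ne x 0 with rfl | hx0
    · simp only [norm_zero]; positivity
    · have hn := congrArg norm h2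
      rw [norm_smul, norm_smul, norm_norm, Real.norm_eq_abs, abs_of_pos hc, mul_comm] at hn
      have hs : c = ‖s‖ := mul_left_cancel₀ (norm_ne_zero_iff.2 hx0) hn
      have := norm_sub_norm_le s s₀
      calc ‖x‖ ≤ B := hx
        _ = B / (c - ‖s₀‖) * (c - ‖s₀‖) := by field_simp
        _ ≤ _ := by gcongr; linarith
  · refine ⟨B / c, by positivity, fun s x hx h => ⟨‖x‖ / c, by positivity,
      fun h => absurd heq h.ne, ?_⟩⟩
    obtain ⟨-, h2⟩ := isSubgradient_const_mul_norm hc h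
    have hx' : x = (‖x‖ / c) • s := by
      rw [div_eq_inv_mul, mul_smul, ← h2, smul_smul, inv_mul_cancel₀ hc.ne', one_smul]
    have : x - (‖x‖ / c) • s₀ = (‖x‖ / c) • (s - s₀) := by
      rw [smul_sub, ← hx']
    rw [this, norm_smul, Real.norm_eq_abs, abs_of_nonneg (by positivity)]
    gcongr

/-- One step of the two-block method decreases the weighted distance to any saddle point. -/
theorem fejer_step [CompleteSpace E] [CompleteSpace F] {f : E → ℝ} (T : E →L[ℝ] F) {b : F}
    {ρ α : ℝ} (hα : 0 < α) {x₂ y x₁' x₂' y' xs ys : E}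
    (h₁ : IsSubgradient f (-(y + ρ • (x₁' - x₂))) x₁')
    (h₂ : y + ρ • (x₁' - x₂') = T.adjoint (T x₂' - b))
    (hy : y' = y + α • (x₁' - x₂'))
    (h₁s : IsSubgradient f (-ys) xs) (h₂s : ys = T.adjoint (T xs - b)) :
    ρ * ‖x₂' - xs‖ ^ 2 + 1 / α * ‖y' - ys‖ ^ 2
      + (ρ * ‖x₁' - x₂‖ ^ 2 + (ρ - α) * ‖x₁' - x₂'‖ ^ 2 + 2 * ‖T x₂' - T xs‖ ^ 2)
      ≤ ρ * ‖x₂ - xs‖ ^ 2 + 1 / α * ‖y - ys‖ ^ 2 := by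
  have m₁ : inner ℝ (y - ys + ρ • (x₁' - x₂)) (x₁' - xs) ≤ 0 := by
    have a := h₁ xs
    have c := h₁s x₁'
    rw [← neg_sub x₁' xs, inner_neg_right] at a
    simp only [inner_neg_left, neg_neg] at a c
    have : y - ys + ρ • (x₁' - x₂) = (y + ρ • (x₁' - x₂)) - ys := by abel
    rw [this, inner_sub_left]
    linarith
  have m₂ : inner ℝ (y - ys + ρ • (x₁' - x₂')) (x₂' - xs) = ‖T x₂' - T xs‖ ^ 2 := by
    have : y - ys + ρ • (x₁' - x₂') = (y + ρ • (x₁' - x₂')) - ys := by abel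
    rw [this, h₂, h₂s, ← map_sub, ContinuousLinearMap.adjoint_inner_left, map_sub,
      sub_sub_sub_cancel_right, real_inner_self_eq_norm_sq]
  obtain ⟨p, hp⟩ : ∃ p, p = x₂' - xs := ⟨_, rfl⟩
  obtain ⟨r, hr⟩ : ∃ r, r = x₁' - x₂' := ⟨_, rfl⟩
  obtain ⟨q, hq⟩ : ∃ q, q = x₂ - xs := ⟨_, rfl⟩
  obtain ⟨η, hη⟩ : ∃ η, η = y - ys := ⟨_, rfl⟩
  have e1 : x₁' - xs = p + r := by rw [hp, hr]; abel
  have e2 : x₁' - x₂ = p + r - q := by rw [hp, hr, hq]; abel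
  have e3 : y' - ys = η + α • r := by rw [hy, hη, hr]; abel
  rw [e1, e2, ← hη] at m₁
  rw [← hη, ← hr, ← hp] at m₂
  rw [e2, e3, ← hη, ← hr, ← hp, ← hq]
  have e4 : 1 / α * ‖η + α • r‖ ^ 2 = 1 / α * ‖η‖ ^ 2 + 2 * inner ℝ η r + α * ‖r‖ ^ 2 := by
    rw [norm_add_sq_real, norm_smul, inner_smul_right, Real.norm_eq_abs, abs_of_pos hα]
    field_simp
  have e5 : ‖p + r - q‖ ^ 2 = ‖p‖ ^ 2 + ‖r‖ ^ 2 + ‖q‖ ^ 2 + 2 * inner ℝ p r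
      - 2 * inner ℝ p q - 2 * inner ℝ r q := by
    rw [norm_sub_sq_real, norm_add_sq_real, inner_add_left]; ring
  simp only [inner_add_left, inner_add_right, inner_sub_left, inner_smul_left, conj_trivial,
    real_inner_self_eq_norm_sq, real_inner_comm p r, real_inner_comm p q,
    real_inner_comm r q] at m₁ m₂
  -- After `m₂` eliminates `‖T x₂' - T xs‖²`, the difference of the two sides is exactly twice the
  -- left side of `m₁`.
  rw [e4, e5]
  linarith [real_inner_comm p η]

end Abstract

/-! ### Hoffman's bound and geometric convergence of Fejér sequences -/

/-- Hoffman's error bound for the polyhedron `{t ≥ 0, A t = c}`. -/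
theorem hoffman_bound {m F : Type*} [Fintype m] [NormedAddCommGroup F] [NormedSpace ℝ F]
    (A : EuclideanSpace ℝ m →L[ℝ] F) (c : F)
    (hne : ∃ t : EuclideanSpace ℝ m, (∀ i, 0 ≤ t i) ∧ A t = c) :
    ∃ κ : ℝ, 0 ≤ κ ∧ ∀ t : EuclideanSpace ℝ m, (∀ i, 0 ≤ t i) →
      ∃ t' : EuclideanSpace ℝ m, (∀ i, 0 ≤ t' i) ∧ A t' = c ∧ ‖t' - t‖ ≤ κ * ‖A t - c‖ := by
  classical
  -- There are finitely many sign cones. On each one that meets the kernel of `A` only in `0`,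
  -- compactness of the unit sphere gives `‖v‖ ≤ κ‖A v‖`. The displacement from `t` to its
  -- projection always lies in such a cone.
  let cone : (m → SignType) → Set (EuclideanSpace ℝ m) := fun σ =>
    {v | ∀ i, 0 ≤ (σ i : ℝ) * v i ∧ (σ i = 0 → v i = 0)}
  have hclosed : ∀ σ, IsClosed (cone σ) := by
    intro σ
    simp only [cone, Set.ofPred_forall, Set.ofPred_and]
    refine isClosed_iInter fun i => IsClosed.inter ?_ ?_
    · exact isClosed_le continuous_const (by fun_prop)
    · exact isClosed_iInter fun _ => isClosed_eq (by fun_prop) continuous_const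
  have hbound : ∀ σ, ∃ κ : ℝ, 0 ≤ κ ∧
      ((∀ v ∈ cone σ, A v = 0 → v = 0) → ∀ v ∈ cone σ, ‖v‖ ≤ κ * ‖A v‖) := by
    intro σ
    by_cases hker : ∀ v ∈ cone σ, A v = 0 → v = 0
    swap
    · exact ⟨0, le_rfl, fun h => absurd h hker⟩
    have hcomp : IsCompact (cone σ ∩ Metric.sphere 0 1) :=
      (isCompact_sphere 0 1).inter_left (hclosed σ)
    rcases (cone σ ∩ Metric.sphere 0 1).eq_empty_or_nonempty with hemp | hnon
    · refine ⟨0, le_rfl, fun _ v hv => ?_⟩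
      by_contra! hpos
      rw [zero_mul] at hpos
      have : ‖v‖⁻¹ • v ∈ cone σ ∩ Metric.sphere 0 1 := by
        refine ⟨fun i => ⟨?_, fun h => ?_⟩, ?_⟩
        · have := mul_nonneg (inv_nonneg.2 hpos.le) (hv i).1
          simpa [mul_left_comm] using this
        · simp [(hv i).2 h]
        · simp [norm_smul, hpos.ne']
      simp [hemp] at this
    · obtain ⟨u, hu, humin⟩ := hcomp.exists_isMinOn hnon
        (f := fun v => ‖A v‖) (by fun_prop)
      have hu1 : ‖u‖ = 1 := by simpa using hu.2
      have hAu : 0 < ‖A u‖ := by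
        refine norm_pos_iff.2 fun h => ?_
        rw [hker u hu.1 h, norm_zero] at hu1
        exact zero_ne_one hu1
      refine ⟨‖A u‖⁻¹, by positivity, fun _ v hv => ?_⟩
      rcases eq_or_ne v 0 with rfl | hv0
      · simp
      have hpos : 0 < ‖v‖ := norm_pos_iff.2 hv0
      have hmem : ‖v‖⁻¹ • v ∈ cone σ ∩ Metric.sphere 0 1 := by
        refine ⟨fun i => ⟨?_, fun h => ?_⟩, ?_⟩
        · have := mul_nonneg (inv_nonneg.2 hpos.le) (hv i).1
          simpa [mul_left_comm] using this
        · simp [(hv i).2 h]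
        · simp [norm_smul, hpos.ne']
      have h := humin hmem
      simp only [Set.mem_ofPred_eq, map_smul, norm_smul, norm_inv, norm_norm] at h
      rw [inv_mul_eq_div, le_div_iff₀ hpos] at h
      rw [inv_mul_eq_div, le_div_iff₀ hAu]
      linarith
  choose κ hκ0 hκ using hbound
  refine ⟨∑ σ, κ σ, Finset.sum_nonneg fun σ _ => hκ0 σ, fun t ht => ?_⟩
  let P : Set (EuclideanSpace ℝ m) := {t | (∀ i, 0 ≤ t i) ∧ A t = c}
  have hPclosed : IsClosed P := by
    simp only [P, Set.ofPred_and, Set.ofPred_forall]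
    exact (isClosed_iInter fun i => isClosed_le continuous_const (by fun_prop)).inter
      (isClosed_eq (by fun_prop) continuous_const)
  have hPconv : Convex ℝ P := by
    intro a ha b hb r s hr hs hrs
    refine ⟨fun i => ?_, ?_⟩
    · simpa using add_nonneg (mul_nonneg hr (ha.1 i)) (mul_nonneg hs (hb.1 i))
    · rw [map_add, map_smul, map_smul, ha.2, hb.2, ← add_smul, hrs, one_smul]
  obtain ⟨t', ht', hmin⟩ := exists_norm_eq_iInf_of_complete_convex hne hPclosed.isComplete hPconv t
  have hproj := (norm_eq_iInf_iff_real_inner_le_zero hPconv ht').1 hmin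
  let σ : m → SignType := fun i => SignType.sign ((t' - t) i)
  have hmem : t' - t ∈ cone σ := by
    refine fun i => ⟨?_, fun h => sign_eq_zero_iff.1 h⟩
    rcases lt_trichotomy ((t' - t) i) 0 with h | h | h
    · simp only [σ, sign_neg h]; norm_num at h ⊢; exact h.le
    · simp [h]
    · simp only [σ, sign_pos h]; norm_num at h ⊢; exact h.le
  -- A kernel vector `v` in this cone is positive only where `t' > t ≥ 0`, so `t' - εv` stays
  -- feasible. Optimality of the projection then gives `⟨t' - t, v⟩ ≤ 0`, although every term of
  -- this sum is nonnegative.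
  have hker : ∀ v ∈ cone σ, A v = 0 → v = 0 := by
    intro v hv hAv
    have hpt : ∀ i, (0 < v i → t i < t' i) ∧ (v i < 0 → t' i < t i) := by
      intro i
      have hvi := hv i
      rcases lt_trichotomy (t' i) (t i) with h | h | h
      · simp only [σ, PiLp.sub_apply, sign_neg (sub_neg.2 h)] at hvi
        norm_num at hvi
        exact ⟨fun h' => absurd h' hvi.not_gt, fun _ => h⟩
      · have h0 := hvi.2 (by simp [σ, h])
        simp [h0]
      · simp only [σ, PiLp.sub_apply, sign_pos (sub_pos.2 h)] at hvi
        norm_num at hvi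
        exact ⟨fun _ => h, fun h' => absurd h' hvi.not_gt⟩
    -- moving from `t'` towards `t` along `v` keeps feasibility
    obtain ⟨ε, hε, hεv⟩ : ∃ ε : ℝ, 0 < ε ∧ ∀ i, 0 ≤ t' i - ε * v i := by
      have : ∀ᶠ ε : ℝ in nhdsWithin 0 (Set.Ioi 0), ∀ i, 0 ≤ t' i - ε * v i := by
        refine Filter.eventually_all.2 fun i => ?_
        rcases le_or_gt (v i) 0 with h | h
        · filter_upwards [self_mem_nhdsWithin] with ε hε
          have := ht'.1 i
          nlinarith [Set.mem_Ioi.1 hε]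
        · have hti : 0 < t' i := (ht i).trans_lt ((hpt i).1 h)
          filter_upwards [Ioo_mem_nhdsGT (div_pos hti h)] with ε hε
          have := (lt_div_iff₀ h).1 hε.2
          linarith
      obtain ⟨ε, h1, h2⟩ := (this.and self_mem_nhdsWithin).exists
      exact ⟨ε, h2, h1⟩
    have hw := hproj (t' - ε • v) ⟨fun i => by simpa using hεv i, by simp [hAv, ht'.2]⟩
    have hinner : inner ℝ (t' - t) v ≤ 0 := by
      have e : t' - ε • v - t' = -(ε • v) := by abel
      rw [e, ← neg_sub t' t, inner_neg_neg, inner_smul_right] at hw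
      exact nonpos_of_mul_nonpos_right hw hε
    rw [PiLp.inner_apply] at hinner
    have hterm : ∀ i, 0 ≤ inner ℝ ((t' - t) i) (v i) ∧
        (inner ℝ ((t' - t) i) (v i) = 0 → v i = 0) := by
      intro i
      simp only [PiLp.sub_apply, RCLike.inner_apply, conj_trivial]
      rcases lt_trichotomy (v i) 0 with h | h | h
      · have := mul_pos_of_neg_of_neg h (sub_neg.2 ((hpt i).2 h))
        exact ⟨this.le, fun h0 => absurd h0 this.ne'⟩
      · simp [h]
      · have := mul_pos h (sub_pos.2 ((hpt i).1 h))
        exact ⟨this.le, fun h0 => absurd h0 this.ne'⟩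
    have hzero := (Finset.sum_eq_zero_iff_of_nonneg fun i _ => (hterm i).1).1
      (le_antisymm hinner (Finset.sum_nonneg fun i _ => (hterm i).1))
    ext i
    exact (hterm i).2 (hzero i (Finset.mem_univ i))
  have h := hκ σ hker _ hmem
  rw [map_sub, ht'.2, norm_sub_rev c] at h
  exact ⟨t', ht'.1, ht'.2, h.trans (mul_le_mul_of_nonneg_right
    (Finset.single_le_sum (fun σ _ => hκ0 σ) (Finset.mem_univ σ)) (norm_nonneg _))⟩

/-- Fejér monotonicity with respect to `S`, together with an error bound of the distance to `S` by
the decrease, gives geometric convergence to a point of `S`. -/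
theorem exists_geometric_bound_of_fejer {E : Type*} [NormedAddCommGroup E] [CompleteSpace E]
    {S : Set E} (hS : IsClosed S) (hne : S.Nonempty) {ρ C : ℝ} (hρ : 0 < ρ)
    (hC : 0 < C) {a : ℕ → E} {e R : ℕ → ℝ} (he : ∀ k, 0 ≤ e k) (hR : ∀ k, 0 ≤ R k)
    (hdec : ∀ k, ∀ x ∈ S, ρ * ‖a (k + 1) - x‖ ^ 2 + e (k + 1) + R k ≤ ρ * ‖a k - x‖ ^ 2 + e k)
    (herr : ∀ k, ∃ x ∈ S, ρ * ‖a (k + 1) - x‖ ^ 2 + e (k + 1) ≤ C * R k) :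
    ∃ x ∈ S, ∃ K q : ℝ, 0 < q ∧ q < 1 ∧
      ∀ k, ‖a k - x‖ ≤ K * q ^ k ∧ e k ≤ K ^ 2 * (q ^ k) ^ 2 ∧ R k ≤ K ^ 2 * (q ^ k) ^ 2 := by
  set D : ℕ → E → ℝ := fun k x => ρ * ‖a k - x‖ ^ 2 + e k with hD
  have hD0 : ∀ k x, 0 ≤ D k x := fun k x => add_nonneg (by positivity) (he k)
  have : Nonempty S := hne.to_subtype
  set δ : ℕ → ℝ := fun k => ⨅ x : S, D k x with hδ
  have hbdd : ∀ k, BddBelow (Set.range fun x : S => D k x) :=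
    fun k => ⟨0, by rintro _ ⟨x, rfl⟩; exact hD0 k x⟩
  have hδ0 : ∀ k, 0 ≤ δ k := fun k => le_ciInf fun x => hD0 k x
  -- Contraction factor obtained from `δ (k+1) ≤ C R k` and `δ (k+1) + R k ≤ δ k`.
  set p : ℝ := C / (1 + C) with hp
  have hp0 : 0 < p := by positivity
  have hp1 : p < 1 := by rw [hp, div_lt_one (by positivity)]; linarith
  have hstep : ∀ k, δ (k + 1) ≤ p * δ k := by
    intro k
    obtain ⟨x, hx, hxR⟩ := herr k
    have h1 : δ (k + 1) ≤ C * R k := (ciInf_le (hbdd (k + 1)) ⟨x, hx⟩).trans hxR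
    have h2 : δ (k + 1) + R k ≤ δ k := by
      refine le_ciInf fun z => ?_
      have := ciInf_le (hbdd (k + 1)) z
      have := hdec k z z.2
      simp only [hD, hδ] at *
      linarith
    rw [hp, div_mul_eq_mul_div, le_div_iff₀ (by positivity)]
    nlinarith
  have hgeo : ∀ k, δ k ≤ p ^ k * δ 0 := by
    intro k
    induction k with
    | zero => simp
    | succ k ih =>
      calc δ (k + 1) ≤ p * δ k := hstep k
        _ ≤ p * (p ^ k * δ 0) := by gcongr
        _ = _ := by ring
  -- The added `1` makes the bound on the infimum strict, even when `δ 0 = 0`, so that a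
  -- near-minimizer exists.
  set L : ℝ := δ 0 + 1 with hL
  have hL0 : 0 < L := by linarith [hδ0 0]
  have hnear : ∀ k, ∃ x ∈ S, D k x ≤ L * p ^ k := by
    intro k
    obtain ⟨x, hx⟩ := exists_lt_of_ciInf_lt
      (show (⨅ x : S, D k x) < L * p ^ k by
        have := hgeo k
        have := pow_pos hp0 k
        simp only [hδ, hL] at *
        nlinarith)
    exact ⟨x, x.2, hx.le⟩
  choose z hzS hz using hnear
  set q : ℝ := Real.sqrt p with hq
  have hq0 : 0 < q := Real.sqrt_pos.2 hp0
  have hqp : q ^ 2 = p := Real.sq_sqrt hp0.le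
  have hq1 : q < 1 := by nlinarith
  have hpk : ∀ k, p ^ k = (q ^ k) ^ 2 := fun k => by rw [← hqp, ← pow_mul, ← pow_mul, mul_comm]
  set K₀ : ℝ := Real.sqrt (L / ρ) with hK₀
  have hK₀0 : 0 ≤ K₀ := Real.sqrt_nonneg _
  have hK₀2 : K₀ ^ 2 = L / ρ := Real.sq_sqrt (by positivity)
  have hdist : ∀ k x, D k x ≤ L * p ^ k → ‖a k - x‖ ≤ K₀ * q ^ k := by
    intro k x h
    have h1 : ρ * ‖a k - x‖ ^ 2 ≤ L * p ^ k := by have := he k; simp only [hD] at h; linarith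
    refine (sq_le_sq₀ (norm_nonneg _) (by positivity)).1 ?_
    rw [mul_pow, hK₀2, ← hpk, div_mul_eq_mul_div, le_div_iff₀ hρ]
    linarith
  have hDR : ∀ k, D (k + 1) (z k) + R k ≤ L * p ^ k := fun k =>
    (hdec k (z k) (hzS k)).trans (hz k)
  have hcauchy : ∀ k, dist (a k) (a (k + 1)) ≤ 2 * K₀ * q ^ k := by
    intro k
    have h1 := hdist k (z k) (hz k)
    have h2 : ‖a (k + 1) - z k‖ ≤ K₀ * q ^ k := by
      have h3 := hDR k
      have : ρ * ‖a (k + 1) - z k‖ ^ 2 ≤ L * p ^ k := by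
        have := he (k + 1)
        have := hR k
        simp only [hD] at h3
        linarith
      refine (sq_le_sq₀ (norm_nonneg _) (by positivity)).1 ?_
      rw [mul_pow, hK₀2, ← hpk, div_mul_eq_mul_div, le_div_iff₀ hρ]
      linarith
    calc dist (a k) (a (k + 1)) ≤ dist (a k) (z k) + dist (a (k + 1)) (z k) :=
          dist_triangle_right _ _ _
      _ ≤ 2 * K₀ * q ^ k := by rw [dist_eq_norm, dist_eq_norm]; linarith
  obtain ⟨x, hx⟩ := cauchySeq_tendsto_of_complete
    (cauchySeq_of_le_geometric q (2 * K₀) hq1 hcauchy)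
  have hqlim : Filter.Tendsto (fun k => K₀ * q ^ k) Filter.atTop (nhds 0) := by
    simpa using (tendsto_pow_atTop_nhds_zero_of_lt_one hq0.le hq1).const_mul K₀
  have hzx : Filter.Tendsto z Filter.atTop (nhds x) := by
    have h0 : Filter.Tendsto (fun k => a k - z k) Filter.atTop (nhds 0) :=
      squeeze_zero_norm (fun k => hdist k (z k) (hz k)) hqlim
    simpa using hx.sub h0
  have hxS : x ∈ S := hS.mem_of_tendsto hzx (Filter.Eventually.of_forall hzS)
  -- The first summand is the geometric tail bounding `a k - x`; the second covers `e` and `R`.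
  set K : ℝ := 2 * K₀ / (1 - q) + Real.sqrt L with hK
  have h1q : 0 < 1 - q := by linarith
  have hKL : L ≤ K ^ 2 := by
    rw [← Real.sq_sqrt hL0.le]
    gcongr
    exact le_add_of_nonneg_left (by positivity)
  refine ⟨x, hxS, K, q, hq0, hq1, fun k => ⟨?_, ?_, ?_⟩⟩
  · have h := dist_le_of_le_geometric_of_tendsto q (2 * K₀) hq1 hcauchy hx k
    rw [dist_eq_norm] at h
    refine h.trans ?_
    rw [hK, add_mul, div_mul_eq_mul_div]
    exact le_add_of_nonneg_right (by positivity)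
  · have h1 := hz k
    rw [← hpk]
    have h2 : 0 ≤ ρ * ‖a k - z k‖ ^ 2 := by positivity
    simp only [hD] at h1
    have := pow_pos hp0 k
    nlinarith
  · have h1 := hDR k
    rw [← hpk]
    have := hD0 (k + 1) (z k)
    have := pow_pos hp0 k
    nlinarith

/-! ### Optimality conditions of the two subproblems -/

section Quadratic

variable {E F : Type*} [NormedAddCommGroup E] [InnerProductSpace ℝ E]
  [NormedAddCommGroup F] [InnerProductSpace ℝ F]

theorem half_mul_norm_sub_sq_eq (ρ : ℝ) (m x v : E) :
    ρ / 2 * ‖v - m‖ ^ 2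
      = ρ / 2 * ‖x - m‖ ^ 2 + inner ℝ (ρ • (x - m)) (v - x) + ρ / 2 * ‖v - x‖ ^ 2 := by
  have : v - m = (x - m) + (v - x) := by abel
  rw [this, norm_add_sq_real, inner_smul_left, conj_trivial]
  ring

theorem half_norm_map_sub_sq_eq [CompleteSpace E] [CompleteSpace F] (T : E →L[ℝ] F) (b : F)
    (x v : E) :
    1 / 2 * ‖T v - b‖ ^ 2
      = 1 / 2 * ‖T x - b‖ ^ 2 + inner ℝ (T.adjoint (T x - b)) (v - x)
        + 1 / 2 * ‖T (v - x)‖ ^ 2 := by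
  have : T v - b = (T x - b) + T (v - x) := by rw [map_sub]; abel
  rw [this, norm_add_sq_real, ContinuousLinearMap.adjoint_inner_left]
  ring

theorem norm_map_sq_le (T : E →L[ℝ] F) (x : E) : ‖T x‖ ^ 2 ≤ ‖T‖ ^ 2 * ‖x‖ ^ 2 := by
  rw [← mul_pow]
  gcongr
  exact T.le_opNorm x

/-- The normal equation of the regularized least squares step. -/
theorem normal_equation [CompleteSpace E] [CompleteSpace F] (T : E →L[ℝ] F) (b : F)
    {ρ : ℝ} (hρ : 0 < ρ) {x u y : E}
    (hmin : ∀ v, 1 / 2 * ‖T x - b‖ ^ 2 + ρ / 2 * ‖x - u - (1 / ρ) • y‖ ^ 2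
      ≤ 1 / 2 * ‖T v - b‖ ^ 2 + ρ / 2 * ‖v - u - (1 / ρ) • y‖ ^ 2) :
    y + ρ • (u - x) = T.adjoint (T x - b) := by
  have h := isSubgradient_of_isMinOn_add (φ := fun _ : E => (0 : ℝ))
    (ψ := fun v => 1 / 2 * ‖T v - b‖ ^ 2 + ρ / 2 * ‖v - u - (1 / ρ) • y‖ ^ 2) (x := x)
    (G := T.adjoint (T x - b) + ρ • (x - (u + (1 / ρ) • y))) (K := 1 / 2 * ‖T‖ ^ 2 + ρ / 2)
    (convexOn_const 0 convex_univ) (fun v => by simpa using hmin v)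
    (fun v => by
      simp only [sub_sub]
      rw [half_norm_map_sub_sq_eq T b x v, half_mul_norm_sub_sq_eq ρ _ x v, inner_add_left]
      linarith [norm_map_sq_le T (v - x)])
  set G := T.adjoint (T x - b) + ρ • (x - (u + (1 / ρ) • y)) with hG
  have h0 := h (x - G)
  rw [sub_sub_cancel_left, inner_neg_neg, real_inner_self_eq_norm_sq] at h0
  have hG0 : G = 0 := by
    rw [← norm_eq_zero]
    nlinarith [norm_nonneg G]
  have e : ρ • (x - (u + (1 / ρ) • y)) = -(y + ρ • (u - x)) := by
    rw [smul_sub, smul_add, smul_smul, mul_one_div_cancel hρ.ne', one_smul, smul_sub]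
    abel
  rw [hG0, e, ← sub_eq_add_neg, eq_comm, sub_eq_zero] at hG
  exact hG.symm

theorem convexOn_const_mul_norm {c : ℝ} (hc : 0 ≤ c) :
    ConvexOn ℝ Set.univ (fun v : E => c * ‖v‖) :=
  convexOn_univ_norm.smul hc

/-- Optimality condition of the proximal step for the norm. -/
theorem isSubgradient_prox {c ρ : ℝ} (hc : 0 ≤ c) (hρ : 0 < ρ) {x u y : E}
    (hmin : ∀ v : E, c * ‖x‖ + ρ / 2 * ‖x - u + (1 / ρ) • y‖ ^ 2
      ≤ c * ‖v‖ + ρ / 2 * ‖v - u + (1 / ρ) • y‖ ^ 2) :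
    IsSubgradient (fun v : E => c * ‖v‖) (-(y + ρ • (x - u))) x := by
  have e : y + ρ • (x - u) = ρ • (x - (u - (1 / ρ) • y)) := by
    rw [smul_sub, smul_sub, smul_sub, smul_smul, mul_one_div_cancel hρ.ne', one_smul]
    abel
  rw [e]
  refine isSubgradient_of_isMinOn_add (ψ := fun v => ρ / 2 * ‖v - u + (1 / ρ) • y‖ ^ 2)
    (K := ρ / 2) (convexOn_const_mul_norm hc) hmin fun v => ?_
  simp only [sub_add]
  exact (half_mul_norm_sub_sq_eq ρ _ x v).le

end Quadratic

/-! ### Block structure, KKT points and the error bound -/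

noncomputable section

variable {ι : Type*} [Fintype ι] {d : ℕ} (grp : ι → Finset (Fin d))

/-- The block projection as a continuous linear map. -/
def blockL (i : ι) : Vec grp →L[ℝ] BlockVec grp i :=
  LinearMap.toContinuousLinearMap
    { toFun := fun x => block grp x i
      map_add' := fun _ _ => rfl
      map_smul' := fun _ _ => rfl }

/-- The matrix `M` as a continuous linear map. -/
def sumL : Vec grp →L[ℝ] EuclideanSpace ℝ (Fin d) :=
  LinearMap.toContinuousLinearMap
    { toFun := applyM grp
      map_add' := fun x y => by simp [applyM, Matrix.mulVec_add]
      map_smul' := fun r x => by simp [applyM, Matrix.mulVec_smul] }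

/-- The vector with prescribed blocks. -/
def ofBlocks (v : ∀ i, BlockVec grp i) : Vec grp :=
  WithLp.toLp 2 fun p => v p.1 p.2

theorem blockL_apply (i : ι) (x : Vec grp) : blockL grp i x = block grp x i := rfl

theorem sumL_apply (x : Vec grp) : sumL grp x = applyM grp x := rfl

variable {grp}

theorem blockL_ofBlocks (v : ∀ i, BlockVec grp i) (i : ι) :
    blockL grp i (ofBlocks grp v) = v i := rfl

theorem inner_eq_sum_blockL (x y : Vec grp) :
    inner ℝ x y = ∑ i, inner ℝ (blockL grp i x) (blockL grp i y) := by
  simp only [PiLp.inner_apply, Fintype.sum_sigma]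
  rfl

theorem norm_sq_eq_sum_blockL (x : Vec grp) : ‖x‖ ^ 2 = ∑ i, ‖blockL grp i x‖ ^ 2 := by
  simp only [← real_inner_self_eq_norm_sq, inner_eq_sum_blockL]

theorem norm_blockL_le (x : Vec grp) (i : ι) : ‖blockL grp i x‖ ≤ ‖x‖ := by
  refine (sq_le_sq₀ (norm_nonneg _) (norm_nonneg _)).1 ?_
  rw [norm_sq_eq_sum_blockL x]
  exact Finset.single_le_sum (f := fun i => ‖blockL grp i x‖ ^ 2) (fun i _ => sq_nonneg _)
    (Finset.mem_univ i)

theorem norm_le_sum_blockL (x : Vec grp) : ‖x‖ ≤ ∑ i, ‖blockL grp i x‖ := by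
  refine (sq_le_sq₀ (norm_nonneg _) (Finset.sum_nonneg fun i _ => norm_nonneg _)).1 ?_
  rw [norm_sq_eq_sum_blockL x]
  exact Finset.sum_sq_le_sq_sum_of_nonneg fun i _ => norm_nonneg _

variable (grp) in
/-- The weighted group norm `∑ c_g ‖x_{j(g)}‖`. -/
def groupNorm (c : ι → ℝ) (x : Vec grp) : ℝ := ∑ i, c i * ‖blockL grp i x‖

theorem objective_eq (lam : ℝ) (w : ι → ℝ) (b : EuclideanSpace ℝ (Fin d)) (x₁ x₂ : Vec grp) :
    objective grp lam w b x₁ x₂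
      = groupNorm grp (fun i => lam * w i) x₁ + 1 / 2 * ‖sumL grp x₂ - b‖ ^ 2 := by
  simp only [objective, groupNorm, Finset.mul_sum, mul_assoc, blockL_apply, sumL_apply]

theorem continuous_groupNorm (c : ι → ℝ) : Continuous (groupNorm grp c) := by
  unfold groupNorm
  fun_prop

theorem convexOn_groupNorm {c : ι → ℝ} (hc : ∀ i, 0 ≤ c i) :
    ConvexOn ℝ Set.univ (groupNorm grp c) := by
  refine ⟨convex_univ, fun x _ y _ r s hr hs hrs => ?_⟩
  simp only [groupNorm, smul_eq_mul, Finset.mul_sum, ← Finset.sum_add_distrib]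
  refine Finset.sum_le_sum fun i _ => ?_
  rw [map_add, map_smul, map_smul]
  exact (convexOn_const_mul_norm (hc i)).2 (Set.mem_univ _) (Set.mem_univ _) hr hs hrs

theorem isSubgradient_groupNorm_iff {c : ι → ℝ} {s x : Vec grp} :
    IsSubgradient (groupNorm grp c) s x ↔
      ∀ i, IsSubgradient (fun v => c i * ‖v‖) (blockL grp i s) (blockL grp i x) := by
  classical
  constructor
  · intro h i v
    -- Perturbing only the block `i` cancels all other terms.
    have h1 := h (ofBlocks grp (Function.update (fun j => blockL grp j x) i v))
    simp only [groupNorm, inner_eq_sum_blockL, ← Finset.sum_add_distrib, map_sub,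
      blockL_ofBlocks] at h1
    rw [← sub_nonneg, ← Finset.sum_sub_distrib, Finset.sum_eq_single i] at h1
    · simpa using h1
    · intro j _ hj
      simp [Function.update_of_ne hj]
    · simp
  · intro h z
    simp only [groupNorm, inner_eq_sum_blockL, ← Finset.sum_add_distrib, map_sub]
    exact Finset.sum_le_sum fun i _ => h i _

/-- The primal problem has a solution, which satisfies the first-order optimality condition. -/
theorem exists_kkt {c : ι → ℝ} (hc : ∀ i, 0 < c i) (b : EuclideanSpace ℝ (Fin d)) :
    ∃ x : Vec grp, IsSubgradient (groupNorm grp c)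
      (-((sumL grp).adjoint (sumL grp x - b))) x := by
  set T := sumL grp
  set Φ : Vec grp → ℝ := fun x => groupNorm grp c x + 1 / 2 * ‖T x - b‖ ^ 2 with hΦ
  have hΦc : Continuous Φ := (continuous_groupNorm c).add (by fun_prop)
  -- Positive weights make the group norm coercive, whatever the kernel of `M`.
  have hbound : ∀ x, Φ x ≤ Φ 0 → ‖x‖ ≤ ∑ i, Φ 0 / c i := by
    intro x hx
    refine (norm_le_sum_blockL x).trans (Finset.sum_le_sum fun i _ => ?_)
    rw [le_div_iff₀ (hc i), mul_comm]
    have h1 : c i * ‖blockL grp i x‖ ≤ groupNorm grp c x :=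
      Finset.single_le_sum (f := fun i => c i * ‖blockL grp i x‖)
        (fun i _ => mul_nonneg (hc i).le (norm_nonneg _)) (Finset.mem_univ i)
    have h2 : groupNorm grp c x ≤ Φ x := le_add_of_nonneg_right (by positivity)
    linarith
  obtain ⟨x, -, hx⟩ := (isCompact_closedBall (0 : Vec grp) (∑ i, Φ 0 / c i)).exists_isMinOn
    ⟨0, by simpa using hbound 0 le_rfl⟩ hΦc.continuousOn
  have hmin : ∀ v, Φ x ≤ Φ v := by
    intro v
    rcases le_total (Φ v) (Φ 0) with h | h
    · exact hx (by simpa using hbound v h)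
    · exact (hx (show (0 : Vec grp) ∈ _ by simpa using hbound 0 le_rfl)).trans h
  refine ⟨x, isSubgradient_of_isMinOn_add (ψ := fun v => 1 / 2 * ‖T v - b‖ ^ 2)
    (K := 1 / 2 * ‖T‖ ^ 2)
    (convexOn_groupNorm fun i => (hc i).le) hmin fun v => ?_⟩
  rw [half_norm_map_sub_sq_eq T b x v]
  linarith [norm_map_sq_le T (v - x)]

section Optimality

variable {lam : ℝ} {w : ι → ℝ} {b : EuclideanSpace ℝ (Fin d)} {x y : Vec grp}

theorem isPrimalOptimal_of_kkt
    (h : IsSubgradient (groupNorm grp fun i => lam * w i)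
      (-((sumL grp).adjoint (sumL grp x - b))) x) :
    IsPrimalOptimal grp lam w b x x := by
  refine ⟨rfl, ?_⟩
  rintro z _ rfl
  rw [objective_eq, objective_eq]
  have h1 := h z
  rw [inner_neg_left] at h1
  rw [half_norm_map_sub_sq_eq (sumL grp) b x z]
  have : 0 ≤ 1 / 2 * ‖sumL grp (z - x)‖ ^ 2 := by positivity
  linarith

/-- Evaluating the Lagrangian at `(x, x)` bounds every dual value by the primal one. At `y`, the
subgradient inequality and the exact quadratic expansion make that value a lower bound of the
Lagrangian, since the linear terms cancel. -/
theorem isDualOptimal_of_kkt (hlam : 0 < lam) (hw : ∀ i, 0 < w i) {ρ : ℝ} (hρ : 0 < ρ)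
    (hy : y = (sumL grp).adjoint (sumL grp x - b))
    (h : IsSubgradient (groupNorm grp fun i => lam * w i) (-y) x) :
    IsDualOptimal grp lam w b ρ y := by
  intro z
  calc augDual grp lam w b ρ z ≤ augLagrangian grp lam w b ρ x x z :=
        ciInf_le (bddBelow_augLagrangian grp hlam hw b hρ z) (x, x)
    _ = objective grp lam w b x x := by simp [augLagrangian]
    _ ≤ augDual grp lam w b ρ y := by
        refine le_ciInf fun v => ?_
        have h1 := h v.1
        have h2 : 0 ≤ 1 / 2 * ‖sumL grp (v.2 - x)‖ ^ 2 := by positivity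
        have h3 : 0 ≤ ρ / 2 * ‖v.1 - v.2‖ ^ 2 := by positivity
        rw [augLagrangian, objective_eq, objective_eq, half_norm_map_sub_sq_eq (sumL grp) b x v.2,
          ← hy]
        simp only [inner_neg_left, inner_sub_right] at h1 ⊢
        linarith

end Optimality

/-- Error bound: a bounded point with a subgradient close to `s` and with image under `M` close to
that of a solution `x₀` is close to the set of solutions. -/
theorem error_bound {c : ι → ℝ} (hc : ∀ i, 0 < c i) {s x₀ : Vec grp}
    (h₀ : IsSubgradient (groupNorm grp c) s x₀) {B : ℝ} (hB : 0 ≤ B) :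
    ∃ K : ℝ, 0 ≤ K ∧ ∀ s' x : Vec grp, ‖x‖ ≤ B → IsSubgradient (groupNorm grp c) s' x →
      ∃ x' : Vec grp, sumL grp x' = sumL grp x₀ ∧ IsSubgradient (groupNorm grp c) s x' ∧
        ‖x - x'‖ ≤ K * (‖s' - s‖ + ‖sumL grp x - sumL grp x₀‖) := by
  classical
  set T := sumL grp
  have h₀' := isSubgradient_groupNorm_iff.1 h₀
  have hs : ∀ i, ‖blockL grp i s‖ ≤ c i := fun i =>
    (isSubgradient_const_mul_norm (hc i) (h₀' i)).1
  -- The radius `max B ‖x₀‖` lets the estimate apply to `x₀` too; with zero subgradient error it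
  -- writes `x₀` as some `J t`, so the polyhedron is nonempty.
  choose K₀ hK₀ hK₀b using fun i =>
    exists_norm_sub_smul_le (hc i) (le_max_of_le_left hB : 0 ≤ max B ‖x₀‖) (hs i)
  let J : EuclideanSpace ℝ ι →L[ℝ] Vec grp := LinearMap.toContinuousLinearMap
    { toFun := fun t => ofBlocks grp fun i => t i • blockL grp i s
      map_add' := fun t u => by ext p; simp [ofBlocks, add_mul]
      map_smul' := fun r t => by ext p; simp [ofBlocks, mul_assoc] }
  have hJ : ∀ t i, blockL grp i (J t) = t i • blockL grp i s := fun t i => rfl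
  -- `N t = 0` encodes that blocks with `‖s_i‖ < c_i` vanish.
  let N : EuclideanSpace ℝ ι →L[ℝ] (ι → ℝ) := LinearMap.toContinuousLinearMap
    { toFun := fun t i => if ‖blockL grp i s‖ < c i then t i else 0
      map_add' := fun t u => by ext i; by_cases h : ‖blockL grp i s‖ < c i <;> simp [h]
      map_smul' := fun r t => by ext i; by_cases h : ‖blockL grp i s‖ < c i <;> simp [h] }
  have hN : ∀ t, N t = 0 ↔ ∀ i, ‖blockL grp i s‖ < c i → t i = 0 := by
    intro t
    rw [funext_iff]
    refine forall_congr' fun i => ?_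
    change (if ‖blockL grp i s‖ < c i then t i else 0) = 0 ↔ _
    simp
  have hpoint : ∀ s' x : Vec grp, ‖x‖ ≤ max B ‖x₀‖ → IsSubgradient (groupNorm grp c) s' x →
      ∃ t : EuclideanSpace ℝ ι, (∀ i, 0 ≤ t i) ∧ N t = 0 ∧
        ‖x - J t‖ ≤ (∑ i, K₀ i) * ‖s' - s‖ := by
    intro s' x hx h
    choose t ht0 htN ht using fun i => hK₀b i _ (blockL grp i x)
      ((norm_blockL_le x i).trans hx) (isSubgradient_groupNorm_iff.1 h i)
    refine ⟨WithLp.toLp 2 t, ht0, (hN _).2 htN, (norm_le_sum_blockL _).trans ?_⟩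
    rw [Finset.sum_mul]
    refine Finset.sum_le_sum fun i _ => ?_
    rw [map_sub, hJ]
    refine (ht i).trans (mul_le_mul_of_nonneg_left ?_ (hK₀ i))
    rw [← map_sub]
    exact norm_blockL_le _ i
  obtain ⟨κ, hκ0, hκ⟩ := hoffman_bound ((T.comp J).prod N) (T x₀, 0) (by
    obtain ⟨t, ht0, htN, ht⟩ := hpoint s x₀ (le_max_right _ _) h₀
    rw [sub_self, norm_zero, mul_zero, norm_le_zero_iff, sub_eq_zero] at ht
    exact ⟨t, ht0, by simp [htN, ← ht]⟩)
  set K₁ := ∑ i, K₀ i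
  have hK₁ : 0 ≤ K₁ := Finset.sum_nonneg fun i _ => hK₀ i
  refine ⟨K₁ + ‖J‖ * (κ * (‖T‖ * K₁ + 1)), by positivity, fun s' x hx h => ?_⟩
  obtain ⟨t, ht0, htN, ht⟩ := hpoint s' x (hx.trans (le_max_left _ _)) h
  obtain ⟨t', ht'0, ht', htt'⟩ := hκ t ht0
  simp only [ContinuousLinearMap.prod_apply, ContinuousLinearMap.comp_apply, Prod.mk.injEq,
    htN, Prod.mk_sub_mk, sub_zero, Prod.norm_mk, norm_zero] at ht' htt'
  rw [max_eq_left (norm_nonneg _)] at htt'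
  refine ⟨J t', ht'.1, isSubgradient_groupNorm_iff.2 fun i => ?_, ?_⟩
  · rw [hJ]
    exact isSubgradient_smul_self (hs i) (ht'0 i) ((hN t').1 ht'.2 i)
  · set e₁ := ‖s' - s‖
    set e₂ := ‖T x - T x₀‖
    have he₁ : 0 ≤ e₁ := norm_nonneg _
    have he₂ : 0 ≤ e₂ := norm_nonneg _
    have h1 : ‖T (J t) - T x₀‖ ≤ ‖T‖ * (K₁ * e₁) + e₂ := by
      have e : T (J t) - T x₀ = (T x - T x₀) - T (x - J t) := by rw [map_sub]; abel
      rw [e]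
      refine (norm_sub_le _ _).trans ?_
      have := (T.le_opNorm (x - J t)).trans (mul_le_mul_of_nonneg_left ht (norm_nonneg T))
      linarith
    have h2 : ‖J t - J t'‖ ≤ ‖J‖ * (κ * (‖T‖ * (K₁ * e₁) + e₂)) := by
      rw [norm_sub_rev, ← map_sub]
      refine (J.le_opNorm _).trans ?_
      gcongr
      exact htt'.trans (mul_le_mul_of_nonneg_left h1 hκ0)
    have h3 : ‖x - J t'‖ ≤ ‖x - J t‖ + ‖J t - J t'‖ := norm_sub_le_norm_sub_add_norm_sub _ _ _
    refine h3.trans ((add_le_add ht h2).trans ?_)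
    have hle : ‖T‖ * (K₁ * e₁) + e₂ ≤ (‖T‖ * K₁ + 1) * (e₁ + e₂) := by
      have : 0 ≤ ‖T‖ * K₁ * e₂ := by positivity
      nlinarith
    calc K₁ * e₁ + ‖J‖ * (κ * (‖T‖ * (K₁ * e₁) + e₂))
        ≤ K₁ * (e₁ + e₂) + ‖J‖ * (κ * ((‖T‖ * K₁ + 1) * (e₁ + e₂))) := by
          gcongr
          linarith
      _ = _ := by ring

end

/-! ### Application to the ADMM iterates -/

section Iterates

variable {ι : Type*} [Fintype ι] {d : ℕ} {grp : ι → Finset (Fin d)} {lam : ℝ} {w : ι → ℝ}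
  {b : EuclideanSpace ℝ (Fin d)} {ρ α : ℝ} {x₁ x₂ y : ℕ → Vec grp}

theorem IsADMM.isSubgradient (h : IsADMM grp lam w b ρ α x₁ x₂ y) (hlam : 0 < lam)
    (hw : ∀ i, 0 < w i) (hρ : 0 < ρ) (k : ℕ) :
    IsSubgradient (groupNorm grp fun i => lam * w i)
      (-(y k + ρ • (x₁ (k + 1) - x₂ k))) (x₁ (k + 1)) := by
  refine isSubgradient_groupNorm_iff.2 fun i => ?_
  have hi := h.step_x₁ k i
  simp only [← blockL_apply] at hi
  rw [map_neg, map_add, map_smul, map_sub]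
  exact isSubgradient_prox (mul_pos hlam (hw i)).le hρ fun v => hi (Set.mem_univ v)

theorem IsADMM.normal_equation (h : IsADMM grp lam w b ρ α x₁ x₂ y) (hρ : 0 < ρ) (k : ℕ) :
    y k + ρ • (x₁ (k + 1) - x₂ (k + 1)) = (sumL grp).adjoint (sumL grp (x₂ (k + 1)) - b) :=
  LOGProx.normal_equation (sumL grp) b hρ fun v => h.step_x₂ k (Set.mem_univ v)

/-- Passage from linear bounds by three residuals to a bound between weighted sums of squares. -/
theorem weighted_sq_le {ρ α Q p r m u v : ℝ} (hα : 0 < α) (hγ : 0 < ρ - α)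
    (hu0 : 0 ≤ u) (hv0 : 0 ≤ v) (hu : u ≤ Q * (p + r + m)) (hv : v ≤ Q * (p + r + m)) :
    ρ * u ^ 2 + 1 / α * v ^ 2 ≤ (ρ + 1 / α) * Q ^ 2 * (3 * (1 / ρ + 1 / (ρ - α) + 1))
      * (ρ * p ^ 2 + (ρ - α) * r ^ 2 + 2 * m ^ 2) := by
  have hρ : 0 < ρ := by linarith
  have hsq : (p + r + m) ^ 2 ≤ 3 * (p ^ 2 + r ^ 2 + m ^ 2) := by
    nlinarith [sq_nonneg (p - r), sq_nonneg (p - m), sq_nonneg (r - m)]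
  have hR : p ^ 2 + r ^ 2 + m ^ 2 ≤ (1 / ρ + 1 / (ρ - α) + 1)
      * (ρ * p ^ 2 + (ρ - α) * r ^ 2 + 2 * m ^ 2) := by
    have e1 : 1 / ρ * (ρ * p ^ 2) = p ^ 2 := by field_simp
    have e2 : 1 / (ρ - α) * ((ρ - α) * r ^ 2) = r ^ 2 := by field_simp
    have n1 : 0 ≤ 1 / ρ * ((ρ - α) * r ^ 2 + 2 * m ^ 2) := by positivity
    have n2 : 0 ≤ 1 / (ρ - α) * (ρ * p ^ 2 + 2 * m ^ 2) := by positivity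
    have n3 : 0 ≤ ρ * p ^ 2 + (ρ - α) * r ^ 2 + m ^ 2 := by positivity
    rw [mul_add] at n1 n2
    rw [add_mul, add_mul, one_mul, mul_add, mul_add, mul_add, mul_add, e1, e2]
    linarith
  calc ρ * u ^ 2 + 1 / α * v ^ 2
      ≤ ρ * (Q * (p + r + m)) ^ 2 + 1 / α * (Q * (p + r + m)) ^ 2 := by gcongr
    _ = (ρ + 1 / α) * Q ^ 2 * (p + r + m) ^ 2 := by ring
    _ ≤ (ρ + 1 / α) * Q ^ 2 * (3 * ((1 / ρ + 1 / (ρ - α) + 1)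
      * (ρ * p ^ 2 + (ρ - α) * r ^ 2 + 2 * m ^ 2))) := by
        refine mul_le_mul_of_nonneg_left ?_ (by positivity)
        linarith
    _ = _ := by simp only [mul_assoc]

/-- The distance of an iterate to the solution set is controlled by the last decrease of the
Lyapunov function. -/
theorem IsADMM.exists_kkt_near (h : IsADMM grp lam w b ρ α x₁ x₂ y) (hlam : 0 < lam)
    (hw : ∀ i, 0 < w i) (hα : 0 < α) (hαρ : α < ρ) {x₀ ys : Vec grp}
    (hys : ys = (sumL grp).adjoint (sumL grp x₀ - b))
    (h₀ : IsSubgradient (groupNorm grp fun i => lam * w i) (-ys) x₀)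
    {B : ℝ} (hB : 0 ≤ B) (hbdd : ∀ k, ‖x₁ (k + 1)‖ ≤ B) :
    ∃ C : ℝ, 0 < C ∧ ∀ k, ∃ x : Vec grp, sumL grp x = sumL grp x₀ ∧
      IsSubgradient (groupNorm grp fun i => lam * w i) (-ys) x ∧
      ρ * ‖x₂ (k + 1) - x‖ ^ 2 + 1 / α * ‖y (k + 1) - ys‖ ^ 2 ≤
        C * (ρ * ‖x₁ (k + 1) - x₂ k‖ ^ 2 + (ρ - α) * ‖x₁ (k + 1) - x₂ (k + 1)‖ ^ 2
          + 2 * ‖sumL grp (x₂ (k + 1)) - sumL grp x₀‖ ^ 2) := by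
  have hρ : 0 < ρ := hα.trans hαρ
  have hγ : 0 < ρ - α := sub_pos.2 hαρ
  obtain ⟨K, hK, hKb⟩ := error_bound (fun i => mul_pos hlam (hw i)) h₀ hB
  set T := sumL grp
  set A := ‖T.adjoint‖ with hA
  have hA0 : 0 ≤ A := norm_nonneg _
  set N := A + 2 * ρ + ‖T‖ + α + 1 with hN
  have hN0 : 0 < N := by positivity
  set Q := 1 + 2 * K * N + N with hQ
  have hQ0 : 0 < Q := by positivity
  refine ⟨(ρ + 1 / α) * Q ^ 2 * (3 * (1 / ρ + 1 / (ρ - α) + 1)), by positivity, fun k => ?_⟩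
  -- The error bound is applied at `x₁ (k+1)`, where a subgradient is known; passing to `x₂ (k+1)`
  -- costs the residual `r`.
  obtain ⟨x, hx, hxs, hxd⟩ := hKb _ _ (hbdd k) (h.isSubgradient hlam hw hρ k)
  refine ⟨x, hx, hxs, ?_⟩
  set p := ‖x₁ (k + 1) - x₂ k‖
  set r := ‖x₁ (k + 1) - x₂ (k + 1)‖
  set m := ‖T (x₂ (k + 1)) - T x₀‖
  have hp : 0 ≤ p := norm_nonneg _
  have hr : 0 ≤ r := norm_nonneg _
  have hm : 0 ≤ m := norm_nonneg _
  have hηv : y k - ys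
      = T.adjoint (T (x₂ (k + 1)) - T x₀) - ρ • (x₁ (k + 1) - x₂ (k + 1)) := by
    have e : T (x₂ (k + 1)) - T x₀ = (T (x₂ (k + 1)) - b) - (T x₀ - b) := by abel
    rw [e, map_sub, ← h.normal_equation hρ k, ← hys]
    abel
  have hη : ‖y k - ys‖ ≤ A * m + ρ * r := by
    rw [hηv]
    refine (norm_sub_le _ _).trans (add_le_add (T.adjoint.le_opNorm _) ?_)
    rw [norm_smul, Real.norm_eq_abs, abs_of_pos hρ]
  have hs : ‖-(y k + ρ • (x₁ (k + 1) - x₂ k)) - -ys‖ ≤ A * m + ρ * r + ρ * p := by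
    have e : -(y k + ρ • (x₁ (k + 1) - x₂ k)) - -ys
        = -((y k - ys) + ρ • (x₁ (k + 1) - x₂ k)) := by abel
    rw [e, norm_neg]
    refine (norm_add_le _ _).trans (add_le_add hη ?_)
    rw [norm_smul, Real.norm_eq_abs, abs_of_pos hρ]
  have hT : ‖T (x₁ (k + 1)) - T x₀‖ ≤ ‖T‖ * r + m := by
    refine (norm_sub_le_norm_sub_add_norm_sub _ (T (x₂ (k + 1))) _).trans ?_
    gcongr
    rw [← map_sub]
    exact T.le_opNorm _
  have hy' : ‖y (k + 1) - ys‖ ≤ A * m + ρ * r + α * r := by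
    have e : y (k + 1) - ys = (y k - ys) + α • (x₁ (k + 1) - x₂ (k + 1)) := by
      rw [h.step_y k]; abel
    rw [e]
    refine (norm_add_le _ _).trans (add_le_add hη ?_)
    rw [norm_smul, Real.norm_eq_abs, abs_of_pos hα]
  have hx₂ : ‖x₂ (k + 1) - x‖ ≤ r + ‖x₁ (k + 1) - x‖ := by
    have := norm_sub_le_norm_sub_add_norm_sub (x₂ (k + 1)) (x₁ (k + 1)) x
    rwa [norm_sub_rev (x₂ (k + 1)) (x₁ (k + 1))] at this
  have hT0 : 0 ≤ ‖T‖ := norm_nonneg T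
  have hb : ∀ {u v : ℝ}, 0 ≤ u → 0 ≤ v → u ≤ N → u * v ≤ N * v :=
    fun _ hv h => mul_le_mul_of_nonneg_right h hv
  have ha₁ : A * m + ρ * r + ρ * p ≤ N * (p + r + m) := by
    linarith [hb hA0 hm (by linarith), hb hρ.le hr (by linarith), hb hρ.le hp (by linarith)]
  have ha₂ : ‖T‖ * r + m ≤ N * (p + r + m) := by
    linarith [hb hT0 hr (by linarith), hb zero_le_one hm (by linarith), mul_nonneg hN0.le hp]
  have ha₃ : A * m + ρ * r + α * r ≤ N * (p + r + m) := by
    linarith [hb hA0 hm (by linarith), hb (add_pos hρ hα).le hr (by linarith),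
      mul_nonneg hN0.le hp]
  have hS0 : 0 ≤ p + r + m := by positivity
  have hu : ‖x₂ (k + 1) - x‖ ≤ Q * (p + r + m) := by
    have h1 : K * (‖-(y k + ρ • (x₁ (k + 1) - x₂ k)) - -ys‖ + ‖T (x₁ (k + 1)) - T x₀‖)
        ≤ K * (N * (p + r + m) + N * (p + r + m)) := by
      gcongr
      · exact hs.trans ha₁
      · exact hT.trans ha₂
    have : 0 ≤ N * (p + r + m) := by positivity
    rw [hQ]
    linarith
  have hv : ‖y (k + 1) - ys‖ ≤ Q * (p + r + m) := by
    have : 0 ≤ K * N * (p + r + m) := by positivity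
    rw [hQ]
    linarith
  exact weighted_sq_le hα hγ (norm_nonneg _) (norm_nonneg _) hu hv

/-- The rate may depend on the starting point: the error bound holds on bounded sets, and its radius
comes from the initial Lyapunov value. -/
theorem IsADMM.convergesLinearly (h : IsADMM grp lam w b ρ α x₁ x₂ y) (hlam : 0 < lam)
    (hw : ∀ i, 0 < w i) (hα : 0 < α) (hαρ : α < ρ) :
    ∃ xs ys : Vec grp, ys = (sumL grp).adjoint (sumL grp xs - b) ∧
      IsSubgradient (groupNorm grp fun i => lam * w i) (-ys) xs ∧
      ConvergesLinearly x₁ x₂ y xs xs ys := by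
  have hρ : 0 < ρ := hα.trans hαρ
  have hγ : 0 < ρ - α := sub_pos.2 hαρ
  obtain ⟨x₀, h₀⟩ := exists_kkt (grp := grp) (fun i => mul_pos hlam (hw i)) b
  obtain ⟨ys, hys⟩ : ∃ ys, ys = (sumL grp).adjoint (sumL grp x₀ - b) := ⟨_, rfl⟩
  rw [← hys] at h₀
  set φ := groupNorm grp fun i => lam * w i
  let S : Set (Vec grp) := {x | sumL grp x = sumL grp x₀ ∧ IsSubgradient φ (-ys) x}
  have hx₀S : x₀ ∈ S := ⟨rfl, h₀⟩
  have hSclosed : IsClosed S := by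
    simp only [S, Set.ofPred_and, IsSubgradient, Set.ofPred_forall]
    refine (isClosed_eq (by fun_prop) continuous_const).inter (isClosed_iInter fun z => ?_)
    exact isClosed_le ((continuous_groupNorm _).add (by fun_prop)) continuous_const
  set R : ℕ → ℝ := fun k => ρ * ‖x₁ (k + 1) - x₂ k‖ ^ 2
    + (ρ - α) * ‖x₁ (k + 1) - x₂ (k + 1)‖ ^ 2
    + 2 * ‖sumL grp (x₂ (k + 1)) - sumL grp x₀‖ ^ 2 with hR
  have hR0 : ∀ k, 0 ≤ R k := fun k => by positivity
  set e : ℕ → ℝ := fun k => 1 / α * ‖y k - ys‖ ^ 2 with he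
  have he0 : ∀ k, 0 ≤ e k := fun k => by positivity
  have hdec : ∀ k, ∀ x ∈ S,
      ρ * ‖x₂ (k + 1) - x‖ ^ 2 + e (k + 1) + R k ≤ ρ * ‖x₂ k - x‖ ^ 2 + e k := by
    intro k x hx
    have := fejer_step (sumL grp) hα (h.isSubgradient hlam hw hρ k) (h.normal_equation hρ k)
      (h.step_y k) hx.2 (hx.1 ▸ hys)
    rwa [hx.1] at this
  set V₀ := ρ * ‖x₂ 0 - x₀‖ ^ 2 + e 0 with hV₀
  have hmono : ∀ k, ρ * ‖x₂ k - x₀‖ ^ 2 + e k ≤ V₀ := by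
    intro k
    induction k with
    | zero => exact le_rfl
    | succ k ih => linarith [hdec k x₀ hx₀S, hR0 k]
  have hsqrt : ∀ z : Vec grp, ρ * ‖z‖ ^ 2 ≤ V₀ → ‖z‖ ≤ Real.sqrt (V₀ / ρ) := by
    intro z hz
    refine Real.le_sqrt_of_sq_le ?_
    rw [le_div_iff₀ hρ]
    linarith
  have hbdd : ∀ k, ‖x₁ (k + 1)‖ ≤ Real.sqrt (V₀ / ρ) + Real.sqrt (V₀ / ρ) + ‖x₀‖ := by
    intro k
    have h1 : ‖x₂ k - x₀‖ ≤ Real.sqrt (V₀ / ρ) :=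
      hsqrt _ (by linarith [hmono k, he0 k])
    have h2 : ‖x₁ (k + 1) - x₂ k‖ ≤ Real.sqrt (V₀ / ρ) := by
      refine hsqrt _ ?_
      have a1 : 0 ≤ ρ * ‖x₂ (k + 1) - x₀‖ ^ 2 := by positivity
      have a2 : 0 ≤ (ρ - α) * ‖x₁ (k + 1) - x₂ (k + 1)‖ ^ 2 := by positivity
      have a3 : 0 ≤ 2 * ‖sumL grp (x₂ (k + 1)) - sumL grp x₀‖ ^ 2 := by positivity
      have a4 := hdec k x₀ hx₀S
      simp only [hR] at a4
      linarith [hmono k, he0 (k + 1)]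
    have e3 : x₁ (k + 1) = (x₁ (k + 1) - x₂ k) + (x₂ k - x₀) + x₀ := by abel
    rw [e3]
    exact (norm_add₃_le).trans (by gcongr)
  obtain ⟨C, hC, herr⟩ := h.exists_kkt_near hlam hw hα hαρ hys h₀ (by positivity) hbdd
  obtain ⟨xs, hxs, K, q, hq0, hq1, hconv⟩ := exists_geometric_bound_of_fejer hSclosed
    ⟨x₀, hx₀S⟩ hρ hC he0 hR0 hdec fun k => by
      obtain ⟨x, hx1, hx2, hx3⟩ := herr k
      exact ⟨x, ⟨hx1, hx2⟩, hx3⟩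
  refine ⟨xs, ys, by rw [hxs.1]; exact hys, hxs.2, ?_⟩
  have hK : 0 ≤ K := by simpa using (norm_nonneg _).trans (hconv 0).1
  have hy : ∀ k, ‖y k - ys‖ ≤ Real.sqrt α * K * q ^ k := by
    intro k
    have h1 := (hconv k).2.1
    refine (sq_le_sq₀ (norm_nonneg _) (by positivity)).1 ?_
    rw [mul_pow, mul_pow, Real.sq_sqrt hα.le]
    simp only [he] at h1
    rw [one_div, inv_mul_eq_div, div_le_iff₀ hα] at h1
    linarith
  have hx₁ : ∀ k, ‖x₁ (k + 1) - xs‖ ≤ (K / Real.sqrt ρ + K) * q ^ k := by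
    intro k
    have h1 : ‖x₁ (k + 1) - x₂ k‖ ≤ K / Real.sqrt ρ * q ^ k := by
      refine (sq_le_sq₀ (norm_nonneg _) (by positivity)).1 ?_
      rw [mul_pow, div_pow, Real.sq_sqrt hρ.le, div_mul_eq_mul_div, le_div_iff₀ hρ]
      have a2 : 0 ≤ (ρ - α) * ‖x₁ (k + 1) - x₂ (k + 1)‖ ^ 2 := by positivity
      have a3 : 0 ≤ 2 * ‖sumL grp (x₂ (k + 1)) - sumL grp x₀‖ ^ 2 := by positivity
      have a4 := (hconv k).2.2
      simp only [hR] at a4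
      linarith
    have := norm_sub_le_norm_sub_add_norm_sub (x₁ (k + 1)) (x₂ k) xs
    linarith [(hconv k).1]
  -- `x₁ 0` is arbitrary and enters no update, so its error goes into the constant; the index shift
  -- for `x₁` costs the factor `1/q`.
  refine ⟨‖x₁ 0 - xs‖ + (K / Real.sqrt ρ + K) / q + K + Real.sqrt α * K, q, hq0, hq1,
    fun k => ?_⟩
  have hx₁' : ‖x₁ k - xs‖ ≤ (‖x₁ 0 - xs‖ + (K / Real.sqrt ρ + K) / q) * q ^ k := by
    cases k with
    | zero =>
      rw [pow_zero, mul_one]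
      exact le_add_of_nonneg_right (by positivity)
    | succ k =>
      have e1 : (K / Real.sqrt ρ + K) / q * q ^ (k + 1) = (K / Real.sqrt ρ + K) * q ^ k := by
        field_simp
        ring
      rw [add_mul, e1]
      exact (hx₁ k).trans (le_add_of_nonneg_left (by positivity))
  linarith [(hconv k).1, hy k]

end Iterates

end LOGProx

theorem mainTheorem1 {ι : Type*} [Fintype ι] {d : ℕ} (grp : ι → Finset (Fin d))
    (lam : ℝ) (hlam : 0 < lam) (w : ι → ℝ) (hw : ∀ i, 0 < w i)
    (b : EuclideanSpace ℝ (Fin d)) (ρ : ℝ) (hρ : 0 < ρ) :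
    ∃ α₀ : ℝ, 0 < α₀ ∧ ∀ α : ℝ, 0 < α → α < α₀ →
      ∀ x₁ x₂ y : ℕ → LOGProx.Vec grp, LOGProx.IsADMM grp lam w b ρ α x₁ x₂ y →
        ∃ x₁s x₂s ys : LOGProx.Vec grp,
          LOGProx.IsPrimalOptimal grp lam w b x₁s x₂s ∧
          LOGProx.IsDualOptimal grp lam w b ρ ys ∧
          LOGProx.ConvergesLinearly x₁ x₂ y x₁s x₂s ys := by
  refine ⟨ρ, hρ, fun α hα hαρ x₁ x₂ y h => ?_⟩
  obtain ⟨xs, ys, hys, hsub, hconv⟩ := h.convergesLinearly hlam hw hα hαρ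
  exact ⟨xs, xs, ys, LOGProx.isPrimalOptimal_of_kkt (hys ▸ hsub),
    LOGProx.isDualOptimal_of_kkt hlam hw hρ hys hsub, hconv⟩
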